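/- Let $n\geq 1$. For a set partition $\pi$ of $[n]=\{1,\dots,n\}$ let $m_\pi=\sum \mathbf{x}_{i_1}\cdots\mathbf{x}_{i_n}$, summed over all tuples $(i_1,\dots,i_n)$ of positive integers with $i_j=i_k$ if and only if $j,k$ lie in the same block of $\pi$, and let $p_\pi=\sum \mathbf{x}_{i_1}\cdots\mathbf{x}_{i_n}$, summed over all tuples with $i_j=i_k$ whenever $j,k$ lie in the same block of $\pi$; these are formal power series over $\mathbb{Q}$ in noncommuting variables $\mathbf{x}_1,\mathbf{x}_2,\dots$. Let $\mathrm{NCSym}$ be the $\mathbb{Q}$-span of all $m_\pi$, over all set partitions $\pi$ of $[k]$ and all $k\ge 0$. Order the set partitions of $[n]$ by refinement ($\sigma\le\pi$ if each block of $\sigma$ is contained in a block of $\pi$), let $\mu$ be the Möbius function of this lattice, and put $x_\pi=\sum_{\sigma\leq\pi}\mu(\sigma,\pi)\,p_\sigma$. Let $[[n]]$ denote the set partition of $[n]$ with a single block. For a set partition $\sigma$ of $[n]$, let $K_\sigma$ be the complete multipartite graph on the vertex set $[n]$ in which $i$ and $j$ are adjacent if and only if they lie in distinct blocks of $\sigma$.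 **Theorem.** For each set partition $\sigma$ of $[n]$ and each vertex $v\in[n]$, let $c_\sigma$ be the number of acyclic orientations of $K_\sigma$ in which $v$ is the only sink; this number does not depend on the choice of $v$. Then $x_{[[n]]}\in\mathrm{NCSym}$ and $$x_{[[n]]}=(-1)^{n-1}\sum_{\sigma\vdash[n]} c_\sigma\, m_\sigma .$$ In particular, the coefficients $a_\sigma$ in any expansion $x_{[[n]]}=\sum_{\sigma\vdash[n]}a_\sigma m_\sigma$ with $a_\sigma\in\mathbb{Q}$ all have the same sign, in the sense that $(-1)^{n-1}a_\sigma\geq 0$ for every $\sigma$. -/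

import Mathlib

namespace NCSymX

/-- Set partitions of `[n]`, modelled on `Fin n`, with Mathlib's refinement order:
`σ ≤ π` iff each block of `σ` is contained in some block of `π`. -/
abbrev SetPartition (n : ℕ) : Type := Finpartition (Finset.univ : Finset (Fin n))

noncomputable instance (n : ℕ) : LocallyFiniteOrder (SetPartition n) := by
  classical exact Fintype.toLocallyFiniteOrder

/-- The set partition of `[n]` with a single block, for `n ≥ 1`. -/
def oneBlock (n : ℕ) (hn : 1 ≤ n) : SetPartition n :=
  Finpartition.indiscrete (a := (Finset.univ : Finset (Fin n)))
    (Finset.nonempty_iff_ne_empty.mp ⟨⟨0, hn⟩, Finset.mem_univ _⟩)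

/-- The block of `σ` containing `j` is `σ.part j`, so this says that `j` and `k` are in the same
block of `σ`. -/
def SameBlock {n : ℕ} (σ : SetPartition n) (j k : Fin n) : Prop := σ.part j = σ.part k

/-- Formal power series over `ℚ` in noncommuting variables `x₁, x₂, …`, as a `ℚ`-vector space: a
series is given by its coefficients on words, i.e. noncommutative monomials. -/
abbrev NCPowerSeries : Type := FreeMonoid ℕ+ → ℚ

/-- The noncommutative monomial `x_{i₁} x_{i₂} ⋯ x_{iₙ}`. -/
def word {n : ℕ} (i : Fin n → ℕ+) : FreeMonoid ℕ+ := FreeMonoid.ofList (List.ofFn i)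

open Classical in
/-- The formal sum of the monomials `x_{i₁} ⋯ x_{iₙ}` over all tuples `(i₁, …, iₙ)` in `T`.
Distinct tuples of the same length give distinct words, so all coefficients are `0` or `1`. -/
noncomputable def formalSum {n : ℕ} (T : Set (Fin n → ℕ+)) : NCPowerSeries :=
  fun w => if ∃ i ∈ T, word i = w then 1 else 0

/-- The monomial symmetric function `m_π` in noncommuting variables. -/
noncomputable def m {n : ℕ} (π : SetPartition n) : NCPowerSeries :=
  formalSum {i | ∀ j k, i j = i k ↔ SameBlock π j k}

/-- The power sum symmetric function `p_π` in noncommuting variables. -/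
noncomputable def p {n : ℕ} (π : SetPartition n) : NCPowerSeries :=
  formalSum {i | ∀ j k, SameBlock π j k → i j = i k}

open Classical in
/-- The extra symmetric function `x_π = ∑_{σ ≤ π} μ(σ, π) p_σ`, where `μ` is the Möbius function
of the lattice of set partitions of `[n]`. -/
noncomputable def x {n : ℕ} (π : SetPartition n) : NCPowerSeries :=
  ∑ σ : SetPartition n with σ ≤ π, IncidenceAlgebra.mu ℚ σ π • p σ

/-- Symmetric functions in noncommuting variables: the sum over `n` of the spans of
the `m_π` with `π` a set partition of `[n]`. -/
noncomputable def NCSym : Submodule ℚ NCPowerSeries :=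
  ⨆ n : ℕ, Submodule.span ℚ (Set.range (m (n := n)))

/-- The complete multipartite graph `K_σ`: `i` and `j` are adjacent iff they lie in distinct
blocks of `σ`. -/
def K {n : ℕ} (σ : SetPartition n) : SimpleGraph (Fin n) where
  Adj i j := ¬ SameBlock σ i j
  symm := ⟨fun _ _ h h' => h h'.symm⟩
  loopless := ⟨fun _ h => h rfl⟩

/-- `D` is an orientation of `G`: every arc of `D` lies on an edge of `G`, and every edge of `G`
is directed in exactly one of its two directions. -/
def IsOrientation {V : Type*} (G : SimpleGraph V) (D : Digraph V) : Prop :=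
  (∀ u v, D.Adj u v → G.Adj u v) ∧ ∀ u v, G.Adj u v → Xor (D.Adj u v) (D.Adj v u)

/-- `D` has no directed cycle. -/
def IsAcyclic {V : Type*} (D : Digraph V) : Prop := ∀ v, ¬ Relation.TransGen D.Adj v v

/-- `v` is a sink of `D`: no arc leaves `v`. -/
def IsSink {V : Type*} (D : Digraph V) (v : V) : Prop := ∀ u, ¬ D.Adj v u

/-- The number of acyclic orientations of `K_σ` whose unique sink is the vertex `v`. -/
noncomputable def c {n : ℕ} (σ : SetPartition n) (v : Fin n) : ℕ :=
  Nat.card {D : Digraph (Fin n) // IsOrientation (K σ) D ∧ IsAcyclic D ∧ ∀ u, IsSink D u ↔ u = v}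

end NCSymX

/-!
Since `p_σ` is the sum of the `m_τ` with `σ ≤ τ`, the coefficient of `m_τ` in `x_{[[n]]}` is
`∑_{σ ≤ τ} μ(σ, 1)`, where `1` is the partition with one block. It is identified with the linear
coefficient of the chromatic polynomial of `K_τ`, which counts acyclic orientations with a
prescribed unique sink.

*Möbius function.* Counting the maps `V → Fin q` that are constant on the blocks of `σ` by their
partition into fibres gives `∑_{π ≥ σ} (q)_{|π|} = q^{|σ|}` (`sum_descPochhammer_Ici`). Taking linear
coefficients, `π ↦ [q] (q)_{|π|}` satisfies the recursion of `μ(·, 1)` (`mu_oneBlock`). The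
partitions of the vertices of `K_τ` into independent blocks are the `σ ≤ τ`, and
`χ_G(q) = ∑ (q)_{|σ|}` over partitions `σ` into independent blocks, so the coefficient above is
`[q] χ_{K_τ}(q)`.

*Chromatic polynomial.* Removing one colour class `B`, an independent set, gives
`χ_G(q + 1) = ∑_B χ_{G - B}(q)`, and by symmetry of the colours
`χ_G(q + 1) = (q + 1) ∑_{B ∋ v} χ_{G - B}(q)`. The second identity at `q = -1` reads
`[q] χ_G(q) = ∑_{B ∋ v} χ_{G - B}(-1)` (`chromPoly_coeff_one`).

*Acyclic orientations.* Acyclic orientations of `G - B` correspond to acyclic orientations of `G` in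
which all vertices of `B` are sinks (`card_acyclic_sinks`). Hence `∑_B (-1)^{|B|} a(G - B)`, with `a`
the number of acyclic orientations, is a sum over acyclic orientations `D` of `G` of the alternating
sum over sets of sinks of `D`, which vanishes because `D` has a sink. This is the recursion of
`χ_G(q + 1)` at `q = -1`, so `χ_G(-1) = (-1)^{|V|} a(G)` (`chromPoly_eval_neg_one`). Restricting to
`B ∋ v`, the alternating sum is `-1` if `v` is the only sink of `D`, and `0` otherwise, which gives
the linear coefficient (`chromPoly_coeff_one_eq`). As the latter does not involve `v`, neither does
the number of orientations.
-/

open Finset Polynomial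

namespace NCSymX

/-! ### Partitions into fibres -/

section Kernel

variable {V C : Type*} [Fintype V] [DecidableEq V]

lemma le_iff_part {σ π : Finpartition (univ : Finset V)} :
    σ ≤ π ↔ ∀ u v, σ.part u = σ.part v → π.part u = π.part v := by
  constructor
  · intro h u v huv
    obtain ⟨t, ht, hle⟩ := h (σ.part_mem.2 (mem_univ v))
    rw [π.part_eq_of_mem ht (hle (huv ▸ σ.mem_part (mem_univ u))),
      π.part_eq_of_mem ht (hle (σ.mem_part (mem_univ v)))]
  · intro h t ht
    obtain ⟨u, hu⟩ := σ.nonempty_of_mem_parts ht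
    refine ⟨π.part u, π.part_mem.2 (mem_univ u), fun v hv => ?_⟩
    rw [π.mem_part_iff_part_eq_part (mem_univ v) (mem_univ u)]
    exact h v u ((σ.part_eq_of_mem ht hv).trans (σ.part_eq_of_mem ht hu).symm)

/-- The partition of `V` into the nonempty fibres of `f`. -/
noncomputable def ker (f : V → C) : Finpartition (univ : Finset V) := by
  classical exact Finpartition.ofSetoid (Setoid.ker f)

lemma ker_part (f : V → C) (u v : V) : (ker f).part u = (ker f).part v ↔ f u = f v := by
  classical
  rw [← Finpartition.mem_part_iff_part_eq_part _ (mem_univ u) (mem_univ v), ker,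
    Finpartition.mem_part_ofSetoid_iff_rel]
  exact eq_comm

lemma le_ker_iff {σ : Finpartition (univ : Finset V)} {f : V → C} :
    σ ≤ ker f ↔ ∀ u v, σ.part u = σ.part v → f u = f v := by
  simp only [le_iff_part, ker_part]

lemma ker_eq_iff {σ : Finpartition (univ : Finset V)} {f : V → C} :
    ker f = σ ↔ ∀ u v, f u = f v ↔ σ.part u = σ.part v := by
  rw [le_antisymm_iff, le_ker_iff, le_iff_part]
  simp only [ker_part]
  exact ⟨fun h u v => ⟨h.1 u v, h.2 u v⟩, fun h => ⟨fun u v => (h u v).1, fun u v => (h u v).2⟩⟩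

/-- The map sending an element to the block of `σ` containing it. -/
def toBlock (σ : Finpartition (univ : Finset V)) (u : V) : σ.parts :=
  ⟨σ.part u, σ.part_mem.2 (mem_univ u)⟩

lemma toBlock_eq_iff {σ : Finpartition (univ : Finset V)} {u v : V} :
    toBlock σ u = toBlock σ v ↔ σ.part u = σ.part v := Subtype.ext_iff

lemma toBlock_surjective (σ : Finpartition (univ : Finset V)) :
    Function.Surjective (toBlock σ) := by
  rintro ⟨t, ht⟩
  obtain ⟨u, hu⟩ := σ.nonempty_of_mem_parts ht
  exact ⟨u, Subtype.ext (σ.part_eq_of_mem ht hu)⟩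

lemma exists_comp_toBlock {σ : Finpartition (univ : Finset V)} {f : V → C} (h : σ ≤ ker f) :
    ∃ g : σ.parts → C, g ∘ toBlock σ = f := by
  refine ⟨f ∘ Function.surjInv (toBlock_surjective σ), funext fun u => ?_⟩
  exact le_ker_iff.1 h _ _ (toBlock_eq_iff.1 (Function.surjInv_eq (toBlock_surjective σ) _))

lemma card_le_ker [Finite C] (σ : Finpartition (univ : Finset V)) :
    Nat.card {f : V → C // σ ≤ ker f} = Nat.card C ^ #σ.parts := by
  have key : Function.Bijective (fun g : σ.parts → C =>
      (⟨g ∘ toBlock σ, le_ker_iff.2 fun u v h => congrArg g (toBlock_eq_iff.2 h)⟩ :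
        {f : V → C // σ ≤ ker f})) := by
    constructor
    · intro g g' h
      exact (toBlock_surjective σ).injective_comp_right (Subtype.ext_iff.1 h)
    · rintro ⟨f, hf⟩
      obtain ⟨g, rfl⟩ := exists_comp_toBlock hf
      exact ⟨g, rfl⟩
  rw [← Nat.card_congr (Equiv.ofBijective _ key), Nat.card_fun]
  simp

lemma card_ker_eq [Finite C] (σ : Finpartition (univ : Finset V)) :
    Nat.card {f : V → C // ker f = σ} = (Nat.card C).descFactorial #σ.parts := by
  have key : Function.Bijective (fun g : σ.parts ↪ C =>
      (⟨g ∘ toBlock σ, ker_eq_iff.2 fun u v => g.injective.eq_iff.trans toBlock_eq_iff⟩ :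
        {f : V → C // ker f = σ})) := by
    constructor
    · intro g g' h
      exact DFunLike.coe_injective
        ((toBlock_surjective σ).injective_comp_right (Subtype.ext_iff.1 h))
    · rintro ⟨f, hf⟩
      obtain ⟨g, rfl⟩ := exists_comp_toBlock hf.ge
      refine ⟨⟨g, fun s t hst => ?_⟩, rfl⟩
      obtain ⟨u, rfl⟩ := toBlock_surjective σ s
      obtain ⟨v, rfl⟩ := toBlock_surjective σ t
      exact toBlock_eq_iff.2 ((ker_eq_iff.1 hf u v).1 hst)
  have := Fintype.ofFinite C
  rw [← Nat.card_congr (Equiv.ofBijective _ key), Nat.card_eq_fintype_card,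
    Fintype.card_embedding_eq]
  simp

/-- Functions are counted according to the partition into fibres. -/
lemma card_ker_pred [Finite C] (Q : Finpartition (univ : Finset V) → Prop) [DecidablePred Q] :
    Nat.card {f : V → C // Q (ker f)} =
      ∑ σ : Finpartition (univ : Finset V) with Q σ, (Nat.card C).descFactorial #σ.parts := by
  classical
  have := Fintype.ofFinite C
  rw [Nat.subtype_card (univ.filter fun f : V → C => Q (ker f)) (by simp),
    card_eq_sum_card_fiberwise (f := ker) (t := univ.filter Q) (fun f hf => by simpa using hf)]
  refine sum_congr rfl fun σ hσ => ?_
  rw [← card_ker_eq, Nat.subtype_card]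
  intro f
  simp only [mem_filter, mem_univ, true_and] at hσ ⊢
  exact ⟨fun h => h.2, fun h => ⟨h ▸ hσ, h⟩⟩

lemma polynomial_ext_nat {P Q : ℚ[X]} (h : ∀ q : ℕ, P.eval (q : ℚ) = Q.eval (q : ℚ)) : P = Q :=
  P.eq_of_infinite_eval_eq Q ((Set.infinite_range_of_injective Nat.cast_injective).mono (by
    rintro _ ⟨q, rfl⟩; exact h q))

/-- Both sides count, at `X = q`, the functions `V → Fin q` that are constant on the blocks
of `σ`. -/
lemma sum_descPochhammer_Ici [DecidableLE (Finpartition (univ : Finset V))]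
    (σ : Finpartition (univ : Finset V)) :
    ∑ π : Finpartition (univ : Finset V) with σ ≤ π, descPochhammer ℚ #π.parts
      = X ^ #σ.parts := by
  refine polynomial_ext_nat fun q => ?_
  have h := (card_ker_pred (C := Fin q) (σ ≤ ·)).symm.trans (card_le_ker σ)
  rw [Nat.card_fin] at h
  simp only [eval_finsetSum, descPochhammer_eval_eq_descFactorial, eval_pow, eval_X]
  exact_mod_cast h

end Kernel

/-! ### Colourings and the chromatic polynomial -/

section Coloring

variable {V : Type*} [Fintype V] [DecidableEq V]

open Classical in
/-- The chromatic polynomial of `G`, written in the falling factorial basis: the coefficient of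
the falling factorial of degree `k` is the number of partitions of `V` into `k` independent
blocks. -/
noncomputable def chromPoly (G : SimpleGraph V) : ℚ[X] :=
  ∑ σ : Finpartition (univ : Finset V) with ∀ u v, σ.part u = σ.part v → ¬ G.Adj u v,
    descPochhammer ℚ #σ.parts

/-- The kernel of a map is independent exactly if the map is a proper colouring. -/
lemma chromPoly_eval (G : SimpleGraph V) (q : ℕ) :
    (chromPoly G).eval (q : ℚ) = Nat.card (G.Coloring (Fin q)) := by
  classical
  let e : G.Coloring (Fin q) ≃
      {f : V → Fin q // ∀ u v, (ker f).part u = (ker f).part v → ¬ G.Adj u v} :=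
    { toFun := fun f => ⟨f, fun u v h hG => f.valid hG ((ker_part _ u v).1 h)⟩
      invFun := fun f => SimpleGraph.Coloring.mk f.1
        fun {u v} hG h => f.2 u v ((ker_part _ u v).2 h) hG
      left_inv := fun f => rfl
      right_inv := fun f => rfl }
  rw [Nat.card_congr e, card_ker_pred
    (fun σ : Finpartition (univ : Finset V) => ∀ u v, σ.part u = σ.part v → ¬ G.Adj u v),
    chromPoly, Nat.card_fin]
  simp only [eval_finsetSum, descPochhammer_eval_eq_descFactorial]
  push_cast
  exact sum_congr (by congr) fun _ _ => rfl

/-- The graph obtained from `G` by deleting the vertices in `B`. -/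
abbrev deleteVerts (G : SimpleGraph V) (B : Finset V) : SimpleGraph {u // u ∉ B} :=
  G.comap Subtype.val

omit [Fintype V] in
/-- A colouring in which `none` is used exactly on the independent set `B` is a colouring of the
remaining vertices with the remaining colours. -/
lemma card_coloring_none_fiber {C : Type*} (G : SimpleGraph V) {B : Finset V}
    (hB : G.IsIndepSet (B : Set V)) :
    Nat.card {f : G.Coloring (Option C) // ∀ u, f u = none ↔ u ∈ B} =
      Nat.card ((deleteVerts G B).Coloring C) := by
  have hval (g : (deleteVerts G B).Coloring C) {u v : V} (huv : G.Adj u v) :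
      (if h : u ∈ B then none else some (g ⟨u, h⟩)) ≠
        (if h : v ∈ B then none else some (g ⟨v, h⟩)) := by
    by_cases hu : u ∈ B <;> by_cases hv : v ∈ B
    · exact absurd huv (hB (mem_coe.2 hu) (mem_coe.2 hv) huv.ne)
    · simp [hu, hv]
    · simp [hu, hv]
    · simp only [hu, hv, dite_false, ne_eq, Option.some.injEq]
      exact g.valid (v := ⟨u, hu⟩) (w := ⟨v, hv⟩) huv
  have key : Function.Bijective (fun g : (deleteVerts G B).Coloring C =>
      (⟨SimpleGraph.Coloring.mk _ (hval g), fun u => by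
        change (if h : u ∈ B then none else some (g ⟨u, h⟩)) = none ↔ _
        by_cases hu : u ∈ B <;> simp [hu]⟩ :
        {f : G.Coloring (Option C) // ∀ u, f u = none ↔ u ∈ B})) := by
    constructor
    · intro g g' h
      ext ⟨u, hu⟩
      have h' : (if h : u ∈ B then none else some (g ⟨u, h⟩)) =
          (if h : u ∈ B then none else some (g' ⟨u, h⟩)) :=
        DFunLike.congr_fun (Subtype.ext_iff.1 h) u
      simpa [hu] using h'
    · rintro ⟨f, hf⟩
      have hsome (u : {u // u ∉ B}) : ∃ c, f u = some c :=
        Option.ne_none_iff_exists'.1 fun h => u.2 ((hf u).1 h)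
      choose g hg using hsome
      refine ⟨SimpleGraph.Coloring.mk g fun {u v} huv h => f.valid (v := u.1) (w := v.1) huv ?_, ?_⟩
      · rw [hg, hg, h]
      · refine Subtype.ext (DFunLike.ext _ _ fun u => ?_)
        change (if h : u ∈ B then none else some (g ⟨u, h⟩)) = f u
        by_cases hu : u ∈ B
        · simp [hu, (hf u).2 hu]
        · simp [hu, hg ⟨u, hu⟩]
  exact (Nat.card_congr (Equiv.ofBijective _ key)).symm

open Classical in
/-- Colourings with one extra colour are counted according to the class of that colour. -/
lemma card_coloring_option {C : Type*} [Finite C] (G : SimpleGraph V) (Q : Finset V → Prop) :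
    Nat.card {f : G.Coloring (Option C) // Q {u | f u = none}} =
      ∑ B ∈ univ.filter fun B : Finset V => G.IsIndepSet (B : Set V) ∧ Q B,
        Nat.card ((deleteVerts G B).Coloring C) := by
  have := Fintype.ofFinite (G.Coloring (Option C))
  let F : G.Coloring (Option C) → Finset V := fun f => {u | f u = none}
  have hF (f : G.Coloring (Option C)) (B : Finset V) : F f = B ↔ ∀ u, f u = none ↔ u ∈ B := by
    simp [F, Finset.ext_iff]
  rw [Nat.subtype_card (univ.filter fun f : G.Coloring (Option C) => Q (F f)) (by simp [F]),
    card_eq_sum_card_fiberwise (f := F)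
      (t := univ.filter fun B : Finset V => G.IsIndepSet (B : Set V) ∧ Q B)]
  · refine sum_congr rfl fun B hB => ?_
    simp only [mem_filter, mem_univ, true_and] at hB
    rw [← card_coloring_none_fiber G hB.1, Nat.subtype_card]
    intro f
    simp only [mem_filter, mem_univ, true_and, ← hF]
    exact ⟨fun h => h.2, fun h => ⟨h ▸ hB.2, h⟩⟩
  · intro f hf
    simp only [coe_filter, mem_univ, true_and, Set.mem_ofPred_eq] at hf ⊢
    refine ⟨fun u hu v hv _ huv => f.valid huv ?_, hf⟩
    simp only [F, coe_filter, mem_univ, true_and, Set.mem_ofPred_eq] at hu hv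
    rw [hu, hv]

/-- A bijection between colour sets induces a bijection between colourings. -/
def recolor {C D : Type*} (G : SimpleGraph V) (e : C ≃ D) : G.Coloring C ≃ G.Coloring D where
  toFun f := SimpleGraph.Coloring.mk (e ∘ f) fun h h' => f.valid h (e.injective h')
  invFun f := SimpleGraph.Coloring.mk (e.symm ∘ f) fun h h' => f.valid h (e.symm.injective h')
  left_inv f := DFunLike.ext _ _ fun u => e.symm_apply_apply (f u)
  right_inv f := DFunLike.ext _ _ fun u => e.apply_symm_apply (f u)

omit [Fintype V] [DecidableEq V] in
lemma card_coloring_fin_succ (G : SimpleGraph V) (q : ℕ) :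
    Nat.card (G.Coloring (Fin (q + 1))) = Nat.card (G.Coloring (Option (Fin q))) :=
  Nat.card_congr (recolor G (finSuccEquiv q))

omit [DecidableEq V] in
/-- By symmetry, each colour is used on `v` equally often. -/
lemma card_coloring_option_eq_mul (G : SimpleGraph V) (v : V) (q : ℕ) :
    Nat.card (G.Coloring (Option (Fin q))) =
      (q + 1) * Nat.card {f : G.Coloring (Option (Fin q)) // f v = none} := by
  have hc (c : Option (Fin q)) : Nat.card {f : G.Coloring (Option (Fin q)) // f v = c} =
      Nat.card {f : G.Coloring (Option (Fin q)) // f v = none} := by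
    refine Nat.card_congr ((recolor G (Equiv.swap c none)).subtypeEquiv fun f => ?_)
    change f v = c ↔ Equiv.swap c none (f v) = none
    rw [Equiv.swap_apply_eq_iff, Equiv.swap_apply_right]
  rw [← Nat.card_congr (Equiv.sigmaFiberEquiv fun f : G.Coloring (Option (Fin q)) => f v),
    Nat.card_sigma, sum_congr rfl fun c _ => hc c]
  simp

open Classical in
/-- `card_coloring_option` without restriction on the class of the extra colour. -/
lemma chromPoly_comp_X_add_one (G : SimpleGraph V) :
    (chromPoly G).comp (X + 1) =
      ∑ B ∈ univ.filter fun B : Finset V => G.IsIndepSet (B : Set V), chromPoly (deleteVerts G B) := by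
  refine polynomial_ext_nat fun q => ?_
  have h := card_coloring_option (C := Fin q) G fun _ => True
  have hq : ((q : ℚ) + 1) = ((q + 1 : ℕ) : ℚ) := by push_cast; rfl
  simp only [eval_comp, eval_add, eval_X, eval_one, eval_finsetSum, hq, chromPoly_eval,
    card_coloring_fin_succ]
  simp only [and_true] at h
  rw [← Nat.card_congr (Equiv.subtypeUnivEquiv fun _ => trivial), h]
  push_cast
  rfl

open Classical in
/-- The factor `X + 1` is the choice of the colour of `v`, and `B` is the class of that colour. -/
lemma chromPoly_comp_X_add_one_eq_mul (G : SimpleGraph V) (v : V) :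
    (chromPoly G).comp (X + 1) = (X + 1) *
      ∑ B ∈ univ.filter fun B : Finset V => G.IsIndepSet (B : Set V) ∧ v ∈ B,
        chromPoly (deleteVerts G B) := by
  refine polynomial_ext_nat fun q => ?_
  have h := card_coloring_option (C := Fin q) G fun B => v ∈ B
  have hq : ((q : ℚ) + 1) = ((q + 1 : ℕ) : ℚ) := by push_cast; rfl
  simp only [eval_comp, eval_add, eval_mul, eval_X, eval_one, eval_finsetSum, hq, chromPoly_eval,
    card_coloring_fin_succ]
  simp only [mem_filter, mem_univ, true_and] at h
  rw [card_coloring_option_eq_mul G v, h]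
  push_cast
  congr!

open Classical in
lemma chromPoly_coeff_one (G : SimpleGraph V) (v : V) :
    (chromPoly G).coeff 1 = ∑ B ∈ univ.filter fun B : Finset V => G.IsIndepSet (B : Set V) ∧ v ∈ B,
      (chromPoly (deleteVerts G B)).eval (-1) := by
  have h := congrArg (fun P : ℚ[X] => P.comp (X - 1)) (chromPoly_comp_X_add_one_eq_mul G v)
  simp only [comp_assoc, mul_comp, add_comp, X_comp, one_comp, sub_add_cancel, comp_X] at h
  rw [h, ← zero_add 1, coeff_X_mul, coeff_zero_eq_eval_zero]
  simp [eval_comp, eval_finsetSum]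

lemma chromPoly_eval_zero [Nonempty V] (G : SimpleGraph V) : (chromPoly G).eval 0 = 0 := by
  have h := chromPoly_eval G 0
  have : IsEmpty (G.Coloring (Fin 0)) := ⟨fun f => (f (Classical.arbitrary V)).elim0⟩
  simpa using h

lemma chromPoly_eval_of_isEmpty [IsEmpty V] (G : SimpleGraph V) (t : ℚ) :
    (chromPoly G).eval t = 1 := by
  have h : chromPoly G = 1 := polynomial_ext_nat fun q => by
    have : Unique (G.Coloring (Fin q)) :=
      ⟨⟨SimpleGraph.Coloring.mk isEmptyElim fun {u} => isEmptyElim u⟩,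
        fun f => DFunLike.ext _ _ isEmptyElim⟩
    simp [chromPoly_eval]
  simp [h]

end Coloring

/-! ### Acyclic orientations and their sinks -/

section AcyclicOrientation

variable {V : Type*} {G : SimpleGraph V} {D : Digraph V} {B : Finset V}

/-- The number of acyclic orientations of `G`. -/
noncomputable def numAcyclic (G : SimpleGraph V) : ℕ :=
  Nat.card {D : Digraph V // IsOrientation G D ∧ IsAcyclic D}

/-- In an acyclic digraph reachability is a strict order; its extremal elements, from which nothing
is reachable, are the sinks. -/
lemma IsAcyclic.exists_isSink [Finite V] [Nonempty V] (hD : IsAcyclic D) : ∃ v, IsSink D v := by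
  let r : V → V → Prop := fun u w => Relation.TransGen D.Adj w u
  have : IsTrans V r := ⟨fun _ _ _ h h' => h'.trans h⟩
  have : Std.Irrefl r := ⟨hD⟩
  obtain ⟨v, -, hv⟩ := (Finite.wellFounded_of_trans_of_irrefl r).has_min Set.univ Set.univ_nonempty
  exact ⟨v, fun u h => hv u trivial (.single h)⟩

/-- The digraph on `V` extending a digraph on the complement of `B`, with all edges of `G` that
meet `B` and its complement directed towards `B`. -/
def extendSinks (G : SimpleGraph V) (D : Digraph {u // u ∉ B}) : Digraph V where
  Adj u w := (u ∉ B ∧ w ∈ B ∧ G.Adj u w) ∨ ∃ hu hw, D.Adj ⟨u, hu⟩ ⟨w, hw⟩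

lemma extendSinks_adj_of_notMem {D : Digraph {u // u ∉ B}} {u w : V} (hu : u ∉ B) (hw : w ∉ B) :
    (extendSinks G D).Adj u w ↔ D.Adj ⟨u, hu⟩ ⟨w, hw⟩ := by
  simp [extendSinks, hu, hw]

lemma extendSinks_adj_of_mem {D : Digraph {u // u ∉ B}} {u w : V} (hu : u ∉ B) (hw : w ∈ B) :
    (extendSinks G D).Adj u w ↔ G.Adj u w := by
  simp [extendSinks, hu, hw]

lemma notMem_of_extendSinks_adj {D : Digraph {u // u ∉ B}} {u w : V}
    (h : (extendSinks G D).Adj u w) : u ∉ B := by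
  rcases h with h | ⟨hu, -⟩
  exacts [h.1, hu]

lemma isSink_extendSinks {D : Digraph {u // u ∉ B}} {b : V} (hb : b ∈ B) :
    IsSink (extendSinks G D) b := fun _ h => notMem_of_extendSinks_adj h hb

lemma transGen_of_extendSinks {D : Digraph {u // u ∉ B}} {u w : V}
    (h : Relation.TransGen (extendSinks G D).Adj u w) (hw : w ∉ B) :
    ∃ hu, Relation.TransGen D.Adj ⟨u, hu⟩ ⟨w, hw⟩ := by
  induction h with
  | single h =>
    have hu := notMem_of_extendSinks_adj h
    exact ⟨hu, .single ((extendSinks_adj_of_notMem hu hw).1 h)⟩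
  | tail _ h ih =>
    have hb := notMem_of_extendSinks_adj h
    obtain ⟨hu, h'⟩ := ih hb
    exact ⟨hu, h'.tail ((extendSinks_adj_of_notMem hb hw).1 h)⟩

lemma isAcyclic_extendSinks {D : Digraph {u // u ∉ B}} (hD : IsAcyclic D) :
    IsAcyclic (extendSinks G D) := by
  intro v h
  obtain ⟨w, hvw, -⟩ := Relation.TransGen.head'_iff.1 h
  obtain ⟨hv, h'⟩ := transGen_of_extendSinks h (notMem_of_extendSinks_adj hvw)
  exact hD _ h'

lemma isOrientation_extendSinks [DecidableEq V] (hB : G.IsIndepSet (B : Set V))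
    {D : Digraph {u // u ∉ B}} (hD : IsOrientation (deleteVerts G B) D) :
    IsOrientation G (extendSinks G D) := by
  refine ⟨fun u w h => ?_, fun u w h => ?_⟩
  · rcases h with h | ⟨hu, hw, h⟩
    exacts [h.2.2, hD.1 _ _ h]
  · by_cases hu : u ∈ B <;> by_cases hw : w ∈ B
    · exact absurd h (hB (mem_coe.2 hu) (mem_coe.2 hw) h.ne)
    · exact Or.inr ⟨(extendSinks_adj_of_mem hw hu).2 h.symm, isSink_extendSinks hu _⟩
    · exact Or.inl ⟨(extendSinks_adj_of_mem hu hw).2 h, isSink_extendSinks hw _⟩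
    · rw [extendSinks_adj_of_notMem hu hw, extendSinks_adj_of_notMem hw hu]
      exact hD.2 ⟨u, hu⟩ ⟨w, hw⟩ h

/-- Acyclic orientations in which all vertices of the independent set `B` are sinks correspond to
acyclic orientations of the graph with `B` deleted. -/
lemma card_acyclic_sinks [DecidableEq V] (hB : G.IsIndepSet (B : Set V)) :
    Nat.card {D : Digraph V // (IsOrientation G D ∧ IsAcyclic D) ∧ ∀ b ∈ B, IsSink D b} =
      numAcyclic (deleteVerts G B) := by
  have key : Function.Bijective
      (fun D : {D : Digraph {u // u ∉ B} // IsOrientation (deleteVerts G B) D ∧ IsAcyclic D} =>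
        (⟨extendSinks G D.1, ⟨isOrientation_extendSinks hB D.2.1, isAcyclic_extendSinks D.2.2⟩,
          fun _ => isSink_extendSinks⟩ :
          {D : Digraph V // (IsOrientation G D ∧ IsAcyclic D) ∧ ∀ b ∈ B, IsSink D b})) := by
    constructor
    · rintro ⟨D, hD⟩ ⟨D', hD'⟩ h
      have h' : extendSinks G D = extendSinks G D' := Subtype.ext_iff.1 h
      refine Subtype.ext (Digraph.ext (funext₂ fun u w => propext ?_))
      rw [← extendSinks_adj_of_notMem (G := G) u.2 w.2, h', extendSinks_adj_of_notMem u.2 w.2]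
    · rintro ⟨D, ⟨hor, hac⟩, hs⟩
      refine ⟨⟨⟨fun u w => D.Adj u w⟩, ⟨fun u w h => hor.1 _ _ h, fun u w h => hor.2 _ _ h⟩,
        fun v h => hac v (Relation.TransGen.lift Subtype.val (fun _ _ h => h) v v h)⟩, ?_⟩
      refine Subtype.ext (Digraph.ext (funext₂ fun u w => propext ?_))
      by_cases hu : u ∈ B
      · exact iff_of_false (isSink_extendSinks hu w) (hs u hu w)
      by_cases hw : w ∈ B
      · refine (extendSinks_adj_of_mem hu hw).trans ⟨fun h => ?_, hor.1 u w⟩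
        exact (hor.2 u w h).elim And.left fun h' => absurd h'.1 (hs w hw u)
      · exact extendSinks_adj_of_notMem hu hw
  exact (Nat.card_congr (Equiv.ofBijective _ key)).symm

lemma isIndepSet_of_isSink (hD : IsOrientation G D) (hB : ∀ b ∈ B, IsSink D b) :
    G.IsIndepSet (B : Set V) := fun u hu w hw _ h =>
  (hD.2 u w h).elim (fun h' => hB u hu w h'.1) fun h' => hB w hw u h'.1

variable [Fintype V] [DecidableEq V]

open Classical in
/-- Double counting of the pairs of an acyclic orientation `D` of `G` and a set `B` of sinks
of `D`. -/
lemma sum_indepSet_numAcyclic (G : SimpleGraph V) (Q : Finset V → Prop) :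
    ∑ B ∈ univ.filter fun B : Finset V => G.IsIndepSet (B : Set V) ∧ Q B,
        (-1 : ℚ) ^ #B * numAcyclic (deleteVerts G B) =
      ∑ D : Digraph V with IsOrientation G D ∧ IsAcyclic D,
        ∑ B ∈ (univ.filter (IsSink D)).powerset with Q B, (-1 : ℚ) ^ #B := by
  rw [sum_comm' (t' := univ.filter fun B : Finset V => G.IsIndepSet (B : Set V) ∧ Q B)
    (s' := fun B => univ.filter fun D : Digraph V =>
      (IsOrientation G D ∧ IsAcyclic D) ∧ ∀ b ∈ B, IsSink D b)]
  · refine sum_congr rfl fun B hB => ?_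
    rw [sum_const, nsmul_eq_mul, mul_comm, ← card_acyclic_sinks (mem_filter.1 hB).2.1,
      Nat.subtype_card (univ.filter fun D : Digraph V =>
        (IsOrientation G D ∧ IsAcyclic D) ∧ ∀ b ∈ B, IsSink D b) (by simp)]
  · intro D B
    simp only [mem_filter, mem_univ, true_and, mem_powerset, subset_iff]
    exact ⟨fun h => ⟨⟨h.1, h.2.1⟩, isIndepSet_of_isSink h.1.1 h.2.1, h.2.2⟩,
      fun h => ⟨h.1.1, h.1.2, h.2.2⟩⟩

omit [Fintype V] in
lemma sum_powerset_neg_one_pow_card_rat {S : Finset V} :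
    ∑ B ∈ S.powerset, (-1 : ℚ) ^ #B = if S = ∅ then 1 else 0 := by
  have h := sum_powerset_neg_one_pow_card (x := S)
  exact_mod_cast congrArg (Int.cast : ℤ → ℚ) h

omit [Fintype V] in
/-- The difference of the alternating sums over the subsets of `S` and of `S.erase v`. -/
lemma sum_powerset_mem_neg_one_pow_card {S : Finset V} {v : V}
    [DecidablePred fun B : Finset V => v ∈ B] :
    ∑ B ∈ S.powerset with v ∈ B, (-1 : ℚ) ^ #B = if S = {v} then -1 else 0 := by
  have h := sum_filter_add_sum_filter_not S.powerset (v ∈ ·) fun B => (-1 : ℚ) ^ #B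
  have h' : S.powerset.filter (v ∉ ·) = (S.erase v).powerset := by
    ext B
    simp [subset_erase]
  rw [h', sum_powerset_neg_one_pow_card_rat, sum_powerset_neg_one_pow_card_rat] at h
  by_cases hv : v ∈ S
  · simp only [ne_empty_of_mem hv, if_false, erase_eq_empty_iff, false_or] at h
    split_ifs at h ⊢ <;> linarith
  · have hS : S ≠ {v} := by rintro rfl; simp at hv
    rw [erase_eq_of_notMem hv] at h
    rw [if_neg hS]
    linarith

open Classical in
lemma sum_indepSet_numAcyclic_eq_zero [Nonempty V] (G : SimpleGraph V) :
    ∑ B ∈ univ.filter fun B : Finset V => G.IsIndepSet (B : Set V),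
        (-1 : ℚ) ^ #B * numAcyclic (deleteVerts G B) = 0 := by
  have h := sum_indepSet_numAcyclic G fun _ => True
  simp only [and_true, filter_true] at h
  rw [h]
  refine sum_eq_zero fun D hD => ?_
  obtain ⟨v, hv⟩ := (mem_filter.1 hD).2.2.exists_isSink
  rw [sum_powerset_neg_one_pow_card_rat, if_neg (ne_empty_of_mem (mem_filter.2 ⟨mem_univ v, hv⟩))]

open Classical in
/-- For each `D`, the alternating sum over sets of sinks containing `v` detects whether `v` is the
only sink. -/
lemma sum_indepSet_mem_numAcyclic (G : SimpleGraph V) (v : V) :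
    ∑ B ∈ univ.filter fun B : Finset V => G.IsIndepSet (B : Set V) ∧ v ∈ B,
        (-1 : ℚ) ^ #B * numAcyclic (deleteVerts G B) =
      -(Nat.card {D : Digraph V // IsOrientation G D ∧ IsAcyclic D ∧ ∀ u, IsSink D u ↔ u = v} :
        ℚ) := by
  rw [Nat.subtype_card ((univ.filter fun D : Digraph V => IsOrientation G D ∧ IsAcyclic D).filter
    fun D => univ.filter (IsSink D) = {v}) (by simp [Finset.ext_iff, and_assoc])]
  have h := sum_indepSet_numAcyclic G (v ∈ ·)
  simp only [sum_powerset_mem_neg_one_pow_card] at h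
  refine Eq.trans (by congr!) (h.trans ?_)
  rw [← sum_filter, sum_const, nsmul_eq_mul, mul_neg_one]

lemma neg_one_pow_card_compl (B : Finset V) :
    (-1 : ℚ) ^ Fintype.card {u // u ∉ B} = (-1) ^ Fintype.card V * (-1) ^ #B := by
  have h : Fintype.card {u // u ∉ B} + #B = Fintype.card V := by
    rw [Fintype.card_subtype_compl, Fintype.card_coe]
    exact Nat.sub_add_cancel (card_le_univ B)
  rw [← h, pow_add, mul_assoc, ← pow_add, Even.neg_one_pow ⟨_, rfl⟩, mul_one]

omit [Fintype V] in
lemma numAcyclic_deleteVerts_empty (G : SimpleGraph V) :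
    numAcyclic (deleteVerts G ∅) = numAcyclic G := by
  rw [← card_acyclic_sinks (by simp [SimpleGraph.IsIndepSet]), numAcyclic]
  simp

lemma chromPoly_deleteVerts_empty (G : SimpleGraph V) :
    chromPoly (deleteVerts G ∅) = chromPoly G := by
  refine polynomial_ext_nat fun q => ?_
  rw [chromPoly_eval, chromPoly_eval]
  exact congrArg _ (Nat.card_congr
    { toFun := fun f => SimpleGraph.Coloring.mk (fun u => f ⟨u, notMem_empty u⟩)
        fun {u v} h => f.valid (v := ⟨u, notMem_empty u⟩) (w := ⟨v, notMem_empty v⟩) h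
      invFun := fun f => SimpleGraph.Coloring.mk (fun u => f u.1) fun {u v} h => f.valid h
      left_inv := fun f => rfl
      right_inv := fun f => rfl })

omit [Fintype V] [DecidableEq V] in
lemma numAcyclic_of_isEmpty [IsEmpty V] (G : SimpleGraph V) : numAcyclic G = 1 := by
  have : Unique {D : Digraph V // IsOrientation G D ∧ IsAcyclic D} :=
    ⟨⟨⟨⟨isEmptyElim⟩, ⟨fun u => isEmptyElim u, fun u => isEmptyElim u⟩, fun u => isEmptyElim u⟩⟩,
      fun D => Subtype.ext (Digraph.ext (funext isEmptyElim))⟩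
  exact Nat.card_unique

end AcyclicOrientation

/-- Stanley's theorem on acyclic orientations. Both sides satisfy the same recursion over the
nonempty independent sets `B`: a colour class on the left, a set of sinks on the right. -/
theorem chromPoly_eval_neg_one {V : Type*} [Fintype V] [DecidableEq V] (G : SimpleGraph V) :
    (chromPoly G).eval (-1) = (-1) ^ Fintype.card V * (numAcyclic G : ℚ) := by
  classical
  induction hn : Fintype.card V using Nat.strong_induction_on generalizing V with
  | _ n ih =>
  subst hn
  rcases isEmpty_or_nonempty V with hV | hV
  · simp [chromPoly_eval_of_isEmpty, numAcyclic_of_isEmpty]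
  have h1 := congrArg (eval (-1 : ℚ)) (chromPoly_comp_X_add_one G)
  simp only [eval_comp, eval_add, eval_X, eval_one, neg_add_cancel, chromPoly_eval_zero,
    eval_finsetSum] at h1
  have h2 := congrArg ((-1 : ℚ) ^ Fintype.card V * ·) (sum_indepSet_numAcyclic_eq_zero G)
  simp only [mul_sum, mul_zero, ← mul_assoc, ← neg_one_pow_card_compl] at h2
  -- The recursions hold for `V` nonempty; their terms for `B = ∅` are isolated.
  have hmem : (∅ : Finset V) ∈ univ.filter fun B : Finset V => G.IsIndepSet (B : Set V) := by
    simp [SimpleGraph.IsIndepSet]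
  rw [← add_sum_erase _ _ hmem] at h1 h2
  have h3 := sum_congr (s₁ := (univ.filter fun B : Finset V => G.IsIndepSet (B : Set V)).erase ∅)
    rfl fun B hB => ih (Fintype.card {u // u ∉ B}) (by
      obtain ⟨b, hb⟩ := nonempty_iff_ne_empty.2 (ne_of_mem_erase hB)
      exact Fintype.card_subtype_lt (p := (· ∉ B)) (x := b) (by simpa using hb))
      (deleteVerts G B) rfl
  rw [h3, chromPoly_deleteVerts_empty] at h1
  rw [numAcyclic_deleteVerts_empty, neg_one_pow_card_compl, card_empty, pow_zero, mul_one] at h2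
  linarith

/-- The Greene–Zaslavsky theorem on acyclic orientations with a prescribed unique sink. -/
theorem chromPoly_coeff_one_eq {V : Type*} [Fintype V] [DecidableEq V] (G : SimpleGraph V)
    (v : V) :
    (chromPoly G).coeff 1 = (-1) ^ (Fintype.card V - 1) *
      (Nat.card {D : Digraph V // IsOrientation G D ∧ IsAcyclic D ∧ ∀ u, IsSink D u ↔ u = v} :
        ℚ) := by
  classical
  have hV : Fintype.card V = Fintype.card V - 1 + 1 :=
    (Nat.sub_add_cancel (Fintype.card_pos_iff.2 ⟨v⟩)).symm
  have h := congrArg ((-1 : ℚ) ^ Fintype.card V * ·) (sum_indepSet_mem_numAcyclic G v)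
  simp only [mul_sum, ← mul_assoc, ← neg_one_pow_card_compl, ← chromPoly_eval_neg_one] at h
  rw [chromPoly_coeff_one G v, h, hV, pow_succ]
  simp

/-! ### Expansion in the monomial basis -/

section Expansion

variable {n : ℕ}

lemma le_oneBlock (hn : 1 ≤ n) (σ : SetPartition n) : σ ≤ oneBlock n hn := fun _ _ =>
  ⟨univ, mem_singleton_self _, subset_univ _⟩

lemma card_parts_eq_one_iff (hn : 1 ≤ n) (σ : SetPartition n) :
    #σ.parts = 1 ↔ σ = oneBlock n hn := by
  constructor
  · intro h
    refine (le_oneBlock hn σ).antisymm (le_iff_part.2 fun u v _ => ?_)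
    exact card_le_one.1 h.le _ (σ.part_mem.2 (mem_univ u)) _ (σ.part_mem.2 (mem_univ v))
  · rintro rfl
    exact card_singleton _

/-- The Möbius function of the partition lattice at the top is the linear coefficient of the
falling factorial, because the latter satisfies the defining recursion. -/
lemma mu_oneBlock [DecidableEq (SetPartition n)] (hn : 1 ≤ n) (σ : SetPartition n) :
    IncidenceAlgebra.mu ℚ σ (oneBlock n hn) = (descPochhammer ℚ #σ.parts).coeff 1 := by
  classical
  let _ : OrderTop (SetPartition n) := { top := oneBlock n hn, le_top := le_oneBlock hn }
  have h := IncidenceAlgebra.moebius_inversion_top (𝕜 := ℚ)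
    (fun π : SetPartition n => (descPochhammer ℚ #π.parts).coeff 1)
    (fun π => if π = oneBlock n hn then 1 else 0) (fun π => by
      have h := congrArg (fun P : ℚ[X] => P.coeff 1) (sum_descPochhammer_Ici π)
      simp only [finsetSum_coeff, coeff_X_pow] at h
      simp only [← card_parts_eq_one_iff, eq_comm (b := 1)]
      rw [← h]
      exact sum_congr (by ext; simp) fun _ _ => rfl) σ
  rw [h]
  simp only [mul_ite, mul_one, mul_zero, sum_ite_eq', mem_Ici, le_oneBlock, if_true]

lemma word_injective : Function.Injective (word (n := n)) := fun _ _ h =>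
  List.ofFn_injective (FreeMonoid.ofList.injective h)

lemma formalSum_word (T : Set (Fin n → ℕ+)) [DecidablePred (· ∈ T)] (i : Fin n → ℕ+) :
    formalSum T (word i) = if i ∈ T then 1 else 0 := by
  have h : (∃ i' ∈ T, word i' = word i) ↔ i ∈ T :=
    ⟨fun ⟨i', hi', h⟩ => word_injective h ▸ hi', fun h => ⟨i, h, rfl⟩⟩
  simp only [formalSum, h]

lemma formalSum_of_forall_ne (T : Set (Fin n → ℕ+)) {w : FreeMonoid ℕ+}
    (h : ∀ i : Fin n → ℕ+, word i ≠ w) : formalSum T w = 0 :=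
  if_neg fun ⟨i, _, hi⟩ => h i hi

open Classical in
lemma m_word (π : SetPartition n) (i : Fin n → ℕ+) :
    m π (word i) = if ker i = π then 1 else 0 := by
  rw [m, formalSum_word]
  exact if_congr ker_eq_iff.symm rfl rfl

open Classical in
lemma p_word (σ : SetPartition n) (i : Fin n → ℕ+) :
    p σ (word i) = if σ ≤ ker i then 1 else 0 := by
  rw [p, formalSum_word]
  exact if_congr le_ker_iff.symm rfl rfl

open Classical in
/-- A word of length `n` contributes only to the `m π` where `π` is its index partition; on words of
other lengths all terms vanish. -/
lemma p_eq_sum_m (σ : SetPartition n) : p σ = ∑ π : SetPartition n with σ ≤ π, m π := by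
  funext w
  rw [Finset.sum_apply]
  by_cases hw : ∃ i : Fin n → ℕ+, word i = w
  · obtain ⟨i, rfl⟩ := hw
    simp only [p_word, m_word, sum_ite_eq, mem_filter, mem_univ, true_and]
  · push Not at hw
    rw [p, formalSum_of_forall_ne _ hw]
    exact (sum_eq_zero fun π _ => formalSum_of_forall_ne _ hw).symm

/-- The independent partitions of `K τ` are the refinements of `τ`. -/
lemma independent_K_iff {σ τ : SetPartition n} :
    (∀ u v, σ.part u = σ.part v → ¬ (K τ).Adj u v) ↔ σ ≤ τ := by
  simp only [K, SameBlock, not_not, le_iff_part]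

open Classical in
/-- The left-hand side is the coefficient of `m τ` in `x (oneBlock n hn)`. -/
lemma sum_mu_oneBlock (hn : 1 ≤ n) (τ : SetPartition n) (v : Fin n) :
    ∑ σ : SetPartition n with σ ≤ τ, IncidenceAlgebra.mu ℚ σ (oneBlock n hn) =
      (-1) ^ (n - 1) * (c τ v : ℚ) := by
  have h := chromPoly_coeff_one_eq (K τ) v
  rw [Fintype.card_fin] at h
  rw [c, ← h, chromPoly, finsetSum_coeff]
  simp only [independent_K_iff, mu_oneBlock]

lemma x_oneBlock_eq (hn : 1 ≤ n) (v : SetPartition n → Fin n) :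
    x (oneBlock n hn) =
      (-1 : ℚ) ^ (n - 1) • ∑ σ : SetPartition n, (c σ (v σ) : ℚ) • m σ := by
  classical
  simp only [x, le_oneBlock, filter_true, p_eq_sum_m, smul_sum]
  rw [sum_comm' (t' := univ) (s' := fun τ => univ.filter (· ≤ τ)) (by simp)]
  refine sum_congr rfl fun τ _ => ?_
  rw [← sum_smul, smul_smul, ← sum_mu_oneBlock hn]

lemma exists_ker_eq (σ : SetPartition n) : ∃ i : Fin n → ℕ+, ker i = σ := by
  obtain ⟨g, hg⟩ := Countable.exists_injective_nat σ.parts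
  refine ⟨fun u => (g (toBlock σ u)).succPNat, ker_eq_iff.2 fun u v => ?_⟩
  rw [Nat.succPNat_inj, hg.eq_iff, toBlock_eq_iff]

/-- The coefficient of `m σ` can be read off from any word with index partition `σ`. -/
lemma coeff_unique {a b : SetPartition n → ℚ} (h : ∑ σ, a σ • m σ = ∑ σ, b σ • m σ) : a = b := by
  classical
  funext σ
  obtain ⟨i, hi⟩ := exists_ker_eq σ
  have h' := congrFun h (word i)
  simpa [Finset.sum_apply, m_word, hi] using h'

end Expansion

end NCSymX

theorem theorem4p1 (n : ℕ) (hn : 1 ≤ n) :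
    -- the number `c σ v` does not depend on the fixed vertex `v`
    (∀ (σ : NCSymX.SetPartition n) (v w : Fin n), NCSymX.c σ v = NCSymX.c σ w) ∧
    NCSymX.x (NCSymX.oneBlock n hn) ∈ NCSymX.NCSym ∧
    -- the expansion, for any choice of a vertex for each `σ`
    (∀ v : NCSymX.SetPartition n → Fin n,
      NCSymX.x (NCSymX.oneBlock n hn) =
        (-1 : ℚ) ^ (n - 1) •
          ∑ σ : NCSymX.SetPartition n, (NCSymX.c σ (v σ) : ℚ) • NCSymX.m σ) ∧
    -- in any expansion over the `m_σ`, all coefficients have the sign `(-1)^(n-1)` or vanish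
    (∀ a : NCSymX.SetPartition n → ℚ,
      NCSymX.x (NCSymX.oneBlock n hn) = ∑ σ : NCSymX.SetPartition n, a σ • NCSymX.m σ →
        ∀ σ, 0 ≤ (-1 : ℚ) ^ (n - 1) * a σ) := by
  classical
  refine ⟨fun σ v w => ?_, ?_, NCSymX.x_oneBlock_eq hn, fun a ha σ => ?_⟩
  · have h := (NCSymX.sum_mu_oneBlock hn σ v).symm.trans (NCSymX.sum_mu_oneBlock hn σ w)
    exact_mod_cast mul_left_cancel₀ (pow_ne_zero _ (by norm_num)) h
  · rw [NCSymX.x_oneBlock_eq hn fun _ => ⟨0, hn⟩]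
    refine Submodule.smul_mem _ _ (Submodule.sum_mem _ fun σ _ => Submodule.smul_mem _ _ ?_)
    exact Submodule.mem_iSup_of_mem n (Submodule.subset_span (Set.mem_range_self σ))
  · rw [NCSymX.x_oneBlock_eq hn fun _ => ⟨0, hn⟩, Finset.smul_sum] at ha
    simp only [smul_smul] at ha
    rw [← NCSymX.coeff_unique ha, ← mul_assoc, ← pow_add, Even.neg_one_pow ⟨_, rfl⟩, one_mul]
    positivity
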